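/- All graphs are finite, simple and nonempty. For graphs $H$ and $T$ let $t(H,T)=\hom(H,T)/v(T)^{v(H)}$ be the homomorphism density, where $\hom(H,T)$ is the number of graph homomorphisms from $H$ to $T$ and $v(\cdot)$ is the number of vertices. The homomorphism density domination exponent of $G$ and $H$ is $$C(G,H)=\min\{c\in\mathbb{R} : t(G,T)\ge t(H,T)^c \text{ for all graphs } T\},$$ whenever this minimum exists. Let $P_m$ denote the path with $m$ edges. Theorem. Let $k,\ell\ge 1$ be integers. Then $C(P_k,P_\ell)$ exists and $$C(P_k,P_\ell)=\begin{cases} \dfrac{k}{\ell} & \text{if } k>\ell \text{ and either } k \text{ is even or both } k,\ell \text{ are odd},\\[2mm] \dfrac{k+1}{\ell} & \text{if } k \text{ is odd and } \ell \text{ is even},\\[2mm] \dfrac{k+1}{\ell+1} & \text{if } k<\ell \text{ and } k \text{ is even},\\[2mm] \dfrac{k+\ell-r}{(a+1)\ell} & \text{if } k<\ell \text{ and } k,\ell \text{ are both odd},\\[2mm] 1 & \text{if } k=\ell, \end{cases}$$ where, in the fourth case, $a=\lfloor \ell/(k+1)\rfloor$ and $r$ is the remainder of that division, i.e. $\ell=a(k+1)+r$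 with integers $a\ge 0$ and $0\le r\le k$. -/

import Mathlib

/-- The homomorphism density `t(G, T) = hom(G, T) / v(T) ^ v(G)`. -/
noncomputable def homDensity {V W : Type*} [Fintype V] [Fintype W]
    (G : SimpleGraph V) (T : SimpleGraph W) : ℝ :=
  (Nat.card (G →g T) : ℝ) / (Fintype.card W : ℝ) ^ Fintype.card V

/-- The set of all real `c` such that `t(G, T) ≥ t(H, T) ^ c` for every (finite, nonempty)
simple graph `T`. -/
def dominationSet {V W : Type*} [Fintype V] [Fintype W]
    (G : SimpleGraph V) (H : SimpleGraph W) : Set ℝ :=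
  {c : ℝ | ∀ (U : Type) [Fintype U] [Nonempty U] (T : SimpleGraph U),
    homDensity G T ≥ homDensity H T ^ c}

/-- `C(G, H)` exists and equals `c`: the number `c` is the minimum of the set of all real exponents
`c` with `t(G, T) ≥ t(H, T) ^ c` for all `T`. -/
def IsDominationExponent {V W : Type*} [Fintype V] [Fintype W]
    (G : SimpleGraph V) (H : SimpleGraph W) (c : ℝ) : Prop :=
  IsLeast (dominationSet G H) c

/-- The path `P_m` with `m` edges, that is, with `m + 1` vertices. -/
abbrev edgePath (m : ℕ) : SimpleGraph (Fin (m + 1)) :=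
  SimpleGraph.pathGraph (m + 1)

/-! Since densities are at most 1, an upper bound on C is a linear inequality between values of u(m)
= log t(P_m, T). All those needed follow from the four facts in `IsPathProfile`: u(0) = 0,
Cauchy–Schwarz (`convex`), deletion of an inner edge (`split`), and t(P_{k+2})^k ≥ t(P_k)^{k+2}
(`growth`). The last is the deep one; it is proved by an entropy argument in
`two_mul_log_totalWalks_le`.

For the lower bounds, a graph H with vertex weights φ is blown up, with parts of relative size
q^(-2φ) and edge densities chosen so that the walks following a given m-edge walk of H from i to j
have density about q^(-(xm + φ i + φ j)). Only the endpoints matter, so as q → ∞ the exponents can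
be compared (`le_mul_of_mem_dominationSet`). Four weighted graphs H give the matching bounds: an
edge with equal weights, an edge with unequal weights, an edge plus an isolated vertex, and a
weighted path with ℓ edges. -/

open Finset Matrix

/-! ### Walk counts and the entropy inequality -/

section WalkCount

variable {U : Type*} [Fintype U] (T : SimpleGraph U)

open Classical in
/-- The number of walks with `m` edges that start at a given vertex. -/
noncomputable def walkCount (m : ℕ) : U → ℝ :=
  T.adjMatrix ℝ ^ m *ᵥ 1

/-- The total number of walks with `m` edges. -/
noncomputable def totalWalks (m : ℕ) : ℝ :=
  ∑ v, walkCount T m v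

lemma walkCount_zero (v : U) : walkCount T 0 v = 1 := by
  simp [walkCount]

open Classical in
lemma walkCount_succ (m : ℕ) (v : U) :
    walkCount T (m + 1) v = ∑ w, T.adjMatrix ℝ v w * walkCount T m w := by
  rw [walkCount, pow_succ', ← mulVec_mulVec]
  rfl

lemma totalWalks_zero : totalWalks T 0 = Fintype.card U := by
  simp [totalWalks, walkCount_zero]

lemma walkCount_nonneg (m : ℕ) (v : U) : 0 ≤ walkCount T m v := by
  classical
  induction m generalizing v with
  | zero => simp [walkCount_zero]
  | succ m ih =>
    rw [walkCount_succ]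
    refine sum_nonneg fun w _ ↦ mul_nonneg ?_ (ih w)
    rw [SimpleGraph.adjMatrix_apply]
    split_ifs <;> norm_num

lemma walkCount_pos {v w : U} (h : T.Adj v w) (m : ℕ) : 0 < walkCount T m v := by
  classical
  induction m generalizing v w with
  | zero => simp [walkCount_zero]
  | succ m ih =>
    rw [walkCount_succ]
    refine sum_pos' (fun x _ ↦ mul_nonneg ?_ (walkCount_nonneg T m x)) ⟨w, mem_univ w, ?_⟩
    · rw [SimpleGraph.adjMatrix_apply]
      split_ifs <;> norm_num
    · simpa [h] using ih h.symm

lemma totalWalks_nonneg (m : ℕ) : 0 ≤ totalWalks T m :=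
  sum_nonneg fun v _ ↦ walkCount_nonneg T m v

lemma totalWalks_pos {v w : U} (h : T.Adj v w) (m : ℕ) : 0 < totalWalks T m :=
  sum_pos' (fun x _ ↦ walkCount_nonneg T m x) ⟨v, mem_univ v, walkCount_pos T h m⟩

open Classical in
lemma sum_adj_mul_walkCount (b : ℕ) (F : U → ℝ) :
    ∑ x, ∑ y, T.adjMatrix ℝ x y * (F x * walkCount T b y) = ∑ x, F x * walkCount T (b + 1) x := by
  refine sum_congr rfl fun x _ ↦ ?_
  rw [walkCount_succ, mul_sum]
  exact sum_congr rfl fun y _ ↦ by ring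

open Classical in
lemma sum_adj_comm (F : U → U → ℝ) :
    ∑ x, ∑ y, T.adjMatrix ℝ x y * F x y = ∑ x, ∑ y, T.adjMatrix ℝ x y * F y x := by
  rw [sum_comm]
  refine sum_congr rfl fun x _ ↦ sum_congr rfl fun y _ ↦ ?_
  simp [T.adj_comm]

lemma totalWalks_add (a b : ℕ) :
    totalWalks T (a + b) = ∑ v, walkCount T a v * walkCount T b v := by
  classical
  induction a generalizing b with
  | zero => simp [walkCount_zero, totalWalks]
  | succ a ih =>
    rw [Nat.add_right_comm, Nat.add_assoc, ih (b + 1),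
      ← sum_adj_mul_walkCount T b (walkCount T a), sum_adj_comm]
    refine Eq.trans ?_ ((sum_adj_mul_walkCount T a (walkCount T b)).trans ?_)
    · exact sum_congr rfl fun x _ ↦ sum_congr rfl fun y _ ↦ by ring
    · exact sum_congr rfl fun x _ ↦ by ring

open Classical in
lemma totalWalks_add_add_one (a b : ℕ) :
    totalWalks T (a + b + 1) =
      ∑ x, ∑ y, T.adjMatrix ℝ x y * (walkCount T a x * walkCount T b y) := by
  rw [sum_adj_mul_walkCount T b, Nat.add_assoc, totalWalks_add]

lemma totalWalks_sq_le (a b : ℕ) :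
    totalWalks T (a + b) ^ 2 ≤ totalWalks T (2 * a) * totalWalks T (2 * b) := by
  rw [totalWalks_add, two_mul, two_mul, totalWalks_add, totalWalks_add]
  simpa [sq] using sum_mul_sq_le_sq_mul_sq univ (walkCount T a) (walkCount T b)

lemma totalWalks_add_add_one_le (a b : ℕ) :
    totalWalks T (a + b + 1) ≤ totalWalks T a * totalWalks T b := by
  classical
  rw [totalWalks_add_add_one, totalWalks, totalWalks, sum_mul_sum]
  refine sum_le_sum fun x _ ↦ sum_le_sum fun y _ ↦ ?_
  refine mul_le_of_le_one_left
    (mul_nonneg (walkCount_nonneg T a x) (walkCount_nonneg T b y)) ?_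
  rw [SimpleGraph.adjMatrix_apply]
  split_ifs <;> norm_num

/-- The entropy-type sum `∑ f_a f_b log (f_a / f_b)` of two walk counts. -/
noncomputable def walkEntropy (a b : ℕ) : ℝ :=
  ∑ v, walkCount T a v * walkCount T b v *
    (Real.log (walkCount T a v) - Real.log (walkCount T b v))

lemma walkEntropy_swap (a b : ℕ) : walkEntropy T a b = -walkEntropy T b a := by
  rw [walkEntropy, walkEntropy, ← sum_neg_distrib]
  exact sum_congr rfl fun v _ ↦ by ring

/-- Jensen for log over adjacent pairs (x, y) with weight f_i(x) f_j(y): the ratio f_{j+1}(x)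
f_{i+1}(y) / (f_i(x) f_j(y)) has mean `c`. It is used in the tangent form log X ≤ X - 1, with X the
ratio divided by `c`. -/
lemma walkEntropy_add_le {v w : U} (h : T.Adj v w) (i j : ℕ) :
    walkEntropy T (j + 1) i + walkEntropy T (i + 1) j ≤
      totalWalks T (i + j + 1) *
        Real.log (totalWalks T (i + j + 3) / totalWalks T (i + j + 1)) := by
  classical
  have h1 := totalWalks_pos T h (i + j + 1)
  have h3 := totalWalks_pos T h (i + j + 3)
  set c := totalWalks T (i + j + 3) / totalWalks T (i + j + 1) with hc
  have hc0 : 0 < c := div_pos h3 h1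
  set f := walkCount T with hf
  have e1 : walkEntropy T (j + 1) i = ∑ x, ∑ y, T.adjMatrix ℝ x y *
      (f i x * (Real.log (f (j + 1) x) - Real.log (f i x)) * f j y) := by
    rw [sum_adj_mul_walkCount T j, walkEntropy]
    exact sum_congr rfl fun x _ ↦ by ring
  have e2 : walkEntropy T (i + 1) j = ∑ x, ∑ y, T.adjMatrix ℝ x y *
      (f j y * (Real.log (f (i + 1) y) - Real.log (f j y)) * f i x) := by
    rw [sum_adj_comm, sum_adj_mul_walkCount T i, walkEntropy]
    exact sum_congr rfl fun x _ ↦ by ring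
  have e3 : totalWalks T (i + j + 1) * Real.log c = ∑ x, ∑ y,
      (T.adjMatrix ℝ x y * (f i x * f j y) * (Real.log c - 1) +
        T.adjMatrix ℝ x y * (f (j + 1) x * f (i + 1) y) * c⁻¹) := by
    simp only [sum_add_distrib, ← sum_mul]
    rw [← totalWalks_add_add_one, ← totalWalks_add_add_one]
    have : j + 1 + (i + 1) + 1 = i + j + 3 := by ring
    rw [this, hc]
    field_simp
    ring
  rw [e1, e2, e3, ← sum_add_distrib]
  refine sum_le_sum fun x _ ↦ ?_
  rw [← sum_add_distrib]
  refine sum_le_sum fun y _ ↦ ?_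
  by_cases hxy : T.Adj x y
  · have p1 := walkCount_pos T hxy i
    have p2 := walkCount_pos T hxy (j + 1)
    have p3 := walkCount_pos T hxy.symm j
    have p4 := walkCount_pos T hxy.symm (i + 1)
    rw [← hf] at p1 p2 p3 p4
    have hX : 0 < f (j + 1) x * f (i + 1) y / (f i x * f j y) / c := by positivity
    have key := Real.log_le_sub_one_of_pos hX
    rw [Real.log_div (by positivity) hc0.ne', Real.log_div (by positivity) (by positivity),
      Real.log_mul p2.ne' p4.ne', Real.log_mul p1.ne' p3.ne'] at key
    have key2 := mul_le_mul_of_nonneg_left key (mul_pos p1 p3).le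
    have e : f i x * f j y * (f (j + 1) x * f (i + 1) y / (f i x * f j y) / c - 1) =
        f (j + 1) x * f (i + 1) y * c⁻¹ - f i x * f j y := by
      field_simp
    rw [e] at key2
    simp only [SimpleGraph.adjMatrix_apply, hxy, if_true]
    linarith
  · simp [hxy]

lemma totalWalks_mul_log_le {v w : U} (h : T.Adj v w) (k : ℕ) :
    totalWalks T k * Real.log (totalWalks T k / Fintype.card U) ≤ walkEntropy T k 0 := by
  have hn : (0 : ℝ) < Fintype.card U := by
    exact_mod_cast Fintype.card_pos_iff.mpr ⟨v⟩
  have hw := totalWalks_pos T h k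
  set c := totalWalks T k / Fintype.card U with hc
  have hc0 : 0 < c := div_pos hw hn
  have e : totalWalks T k * Real.log c =
      ∑ v, (walkCount T k v * (Real.log c + 1) - c) := by
    rw [sum_sub_distrib, ← sum_mul, ← totalWalks, sum_const, card_univ, nsmul_eq_mul, hc]
    field_simp
    ring
  rw [e, walkEntropy]
  refine sum_le_sum fun v _ ↦ ?_
  rw [walkCount_zero, Real.log_one, mul_one, sub_zero]
  rcases (walkCount_nonneg T k v).eq_or_lt with h0 | h0
  · rw [← h0]
    simp [hc0.le]
  · have key := Real.log_le_sub_one_of_pos (div_pos hc0 h0)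
    rw [Real.log_div hc0.ne' h0.ne'] at key
    have key2 := mul_le_mul_of_nonneg_left key h0.le
    have e : walkCount T k v * (c / walkCount T k v - 1) = c - walkCount T k v := by
      field_simp
    rw [e] at key2
    linarith

/-- By antisymmetry of `walkEntropy`, the previous bounds with i + j + 1 = k telescope from E(k, 0)
to E(0, k) = -E(k, 0). Convexity of t log t then bounds E(k, 0) from below. -/
lemma two_mul_log_totalWalks_le {v w : U} (h : T.Adj v w) (k : ℕ) :
    2 * Real.log (totalWalks T k / Fintype.card U) ≤
      k * Real.log (totalWalks T (k + 2) / totalWalks T k) := by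
  have hw := totalWalks_pos T h k
  have step : ∀ i ∈ range k, walkEntropy T (k - i) i - walkEntropy T (k - (i + 1)) (i + 1) ≤
      totalWalks T k * Real.log (totalWalks T (k + 2) / totalWalks T k) := by
    intro i hi
    have hi' := mem_range.mp hi
    obtain ⟨j, rfl⟩ : ∃ j, k = i + j + 1 := ⟨k - i - 1, by omega⟩
    have := walkEntropy_add_le T h i j
    rw [walkEntropy_swap T (i + 1) j] at this
    rwa [show i + j + 1 - i = j + 1 by omega, show i + j + 1 - (i + 1) = j by omega,
      sub_eq_add_neg]
  have tot := sum_le_sum step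
  rw [sum_range_sub' (fun i ↦ walkEntropy T (k - i) i), sum_const, card_range, nsmul_eq_mul,
    Nat.sub_zero, Nat.sub_self, walkEntropy_swap T 0 k] at tot
  have := totalWalks_mul_log_le T h k
  refine le_of_mul_le_mul_left ?_ hw
  linarith

end WalkCount

/-! ### Path homomorphisms are walks -/

section Density

variable {U : Type*} [Fintype U] (T : SimpleGraph U)

open Classical in
lemma sum_prod_adjMatrix (m : ℕ) (F : U → ℝ) :
    ∑ p : Fin (m + 1) → U, F (p 0) * ∏ i : Fin m, T.adjMatrix ℝ (p i.castSucc) (p i.succ) =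
      ∑ v, F v * walkCount T m v := by
  induction m generalizing F with
  | zero =>
    simp only [univ_eq_empty, prod_empty, mul_one, walkCount_zero]
    exact Fintype.sum_equiv (Equiv.funUnique (Fin 1) U) _ _ fun p ↦ rfl
  | succ m ih =>
    rw [← (Fin.consEquiv fun _ : Fin (m + 2) ↦ U).sum_comp, Fintype.sum_prod_type]
    refine sum_congr rfl fun v _ ↦ ?_
    rw [walkCount_succ, mul_sum]
    simp only [← mul_assoc]
    -- The first edge is absorbed into the weight of the new initial vertex; this is why `F` is
    -- arbitrary.
    rw [← ih fun w ↦ F v * T.adjMatrix ℝ v w]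
    refine sum_congr rfl fun p _ ↦ ?_
    rw [Fin.prod_univ_succ]
    simp [Fin.consEquiv]

lemma card_hom_edgePath (m : ℕ) : (Nat.card (edgePath m →g T) : ℝ) = totalWalks T m := by
  classical
  have e : (edgePath m →g T) ≃
      {p : Fin (m + 1) → U // ∀ i : Fin m, T.Adj (p i.castSucc) (p i.succ)} :=
    { toFun := fun φ ↦ ⟨φ, fun i ↦ φ.map_rel (by
        simp [SimpleGraph.pathGraph_adj])⟩
      invFun := fun p ↦ ⟨p.1, by
        intro a b hab
        rcases SimpleGraph.pathGraph_adj.mp hab with h | h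
        · convert p.2 ⟨a, by omega⟩ using 2
          · rfl
          · exact Fin.ext h.symm
        · convert (p.2 ⟨b, by omega⟩).symm using 2
          · exact Fin.ext h.symm
          · rfl⟩
      left_inv := fun φ ↦ rfl
      right_inv := fun p ↦ rfl }
  rw [Nat.card_congr e, Nat.card_eq_fintype_card, Fintype.card_subtype]
  have := sum_prod_adjMatrix T m fun _ ↦ 1
  simp only [one_mul] at this
  rw [totalWalks, ← this, card_filter]
  push_cast
  refine sum_congr rfl fun p _ ↦ ?_
  simp only [SimpleGraph.adjMatrix_apply]
  rw [prod_ite_zero]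
  simp

lemma homDensity_edgePath (m : ℕ) :
    homDensity (edgePath m) T = totalWalks T m / (Fintype.card U : ℝ) ^ (m + 1) := by
  rw [homDensity, card_hom_edgePath, Fintype.card_fin]

end Density

/-! ### Upper bounds from the path profile -/

section UpperBounds

/-- A positive value forces a positive increment before it; by convexity the sequence never
decreases afterwards, so it is positive at a later multiple of `d`. -/
lemma convex_seq_nonpos {h : ℕ → ℝ} (hc : ∀ j, 2 * h (j + 1) ≤ h j + h (j + 2)) (h0 : h 0 ≤ 0)
    {d : ℕ} (hd : 0 < d) (hq : ∀ q, h (q * d) ≤ 0) (j : ℕ) : h j ≤ 0 := by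
  by_contra! hj
  have hmono : Monotone fun i ↦ h (i + 1) - h i :=
    monotone_nat_of_le_succ fun i ↦ by linarith [hc i]
  obtain ⟨i, hi, hpos⟩ : ∃ i < j, 0 < h (i + 1) - h i := by
    by_contra! H
    have := sum_nonpos fun i hi ↦ H i (mem_range.mp hi)
    rw [sum_range_sub] at this
    linarith
  have hge : ∀ m, j ≤ m → h j ≤ h m := by
    intro m hm
    induction m, hm using Nat.le_induction with
    | base => exact le_rfl
    | succ m hm ih =>
      have := hmono (show i ≤ m by omega)
      simp only at this
      linarith
  have := hge (j * d) (Nat.le_mul_of_pos_right j hd)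
  linarith [hq j]

/-- The inequalities satisfied by the logarithms of the path densities of a graph with an edge. -/
structure IsPathProfile (u : ℕ → ℝ) : Prop where
  zero : u 0 = 0
  convex : ∀ a b, 2 * u (a + b) ≤ u (2 * a) + u (2 * b)
  split : ∀ a b, u (a + b + 1) ≤ u a + u b
  growth : ∀ k, (k + 2) * u k ≤ k * u (k + 2)

namespace IsPathProfile

variable {u : ℕ → ℝ}

lemma succ_le (hu : IsPathProfile u) (m : ℕ) : u (m + 1) ≤ u m := by
  simpa [hu.zero] using hu.split m 0

/-- Deleting q edges cuts the long path into q + 1 copies of P_k. -/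
lemma split_mul (hu : IsPathProfile u) (k q : ℕ) : u ((q + 1) * (k + 1) - 1) ≤ (q + 1) * u k := by
  induction q with
  | zero => simp
  | succ q ih =>
    have := hu.split ((q + 1) * (k + 1) - 1) k
    have e : (q + 1) * (k + 1) - 1 + k + 1 = (q + 1 + 1) * (k + 1) - 1 := by
      have : 0 < (q + 1) * (k + 1) := by positivity
      rw [add_one_mul (q + 1)]
      omega
    rw [e] at this
    push_cast
    linarith

lemma growth_add (hu : IsPathProfile u) (k j : ℕ) (hk : 1 ≤ k) : (k + 2 * j) * u k ≤ k * u (k + 2 * j) := by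
  induction j with
  | zero => simp
  | succ j ih =>
    have hk' : (1 : ℝ) ≤ k := by exact_mod_cast hk
    have := hu.growth (k + 2 * j)
    push_cast at this ⊢
    rw [show k + 2 * (j + 1) = k + 2 * j + 2 by ring]
    have hp : (0 : ℝ) < k + 2 * j := by positivity
    refine le_of_mul_le_mul_left ?_ hp
    nlinarith [mul_le_mul_of_nonneg_left this (by positivity : (0 : ℝ) ≤ k),
      mul_le_mul_of_nonneg_left ih (by positivity : (0 : ℝ) ≤ k + 2 * j + 2)]

lemma growth_of_parity (hu : IsPathProfile u) {k l : ℕ} (hl : 1 ≤ l) (hlk : l ≤ k) (h : Even k ↔ Even l) :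
    k * u l ≤ l * u k := by
  obtain ⟨j, hj⟩ : Even (k - l) := (Nat.even_sub hlk).mpr h
  obtain rfl : k = l + 2 * j := by omega
  simpa using hu.growth_add l j hl

lemma growth_odd_succ (hu : IsPathProfile u) {l : ℕ} (hl : Odd l) : (l + 1) * u l ≤ l * u (l + 1) := by
  obtain ⟨j, rfl⟩ := hl
  have h1 := hu.convex j (j + 1)
  have h2 := hu.growth (2 * j)
  rw [show j + (j + 1) = 2 * j + 1 by ring, show 2 * (j + 1) = 2 * j + 1 + 1 by ring] at h1
  rw [show 2 * j + 2 = 2 * j + 1 + 1 by ring] at h2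
  push_cast at h2 ⊢
  have hj : (0 : ℝ) ≤ j := by positivity
  nlinarith [mul_le_mul_of_nonneg_left h1 (by positivity : (0 : ℝ) ≤ 2 * j + 2)]

lemma le_of_even (hu : IsPathProfile u) {k l : ℕ} (hl : 1 ≤ l) (hlk : l < k) (hk : Even k) : k * u l ≤ l * u k := by
  by_cases h : Even l
  · exact hu.growth_of_parity hl hlk.le (by simp [hk, h])
  · have ho := Nat.not_even_iff_odd.mp h
    have h1 := hu.growth_odd_succ ho
    have h2 := hu.growth_of_parity (k := k) (l := l + 1) (by omega) hlk
      (by simp [hk, ho.add_one])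
    push_cast at h2
    have hl' : (0 : ℝ) < l + 1 := by positivity
    refine le_of_mul_le_mul_left ?_ hl'
    nlinarith [mul_le_mul_of_nonneg_left h1 (by positivity : (0 : ℝ) ≤ k),
      mul_le_mul_of_nonneg_left h2 (by positivity : (0 : ℝ) ≤ l)]

lemma le_of_odd_even (hu : IsPathProfile u) {k l : ℕ} (hl : 1 ≤ l) (hk : Odd k) (hle : Even l) :
    (k + 1) * u l ≤ l * u k := by
  rcases le_or_gt l (k + 1) with h | h
  · have h1 := hu.growth_of_parity (k := k + 1) hl h (by simp [hle, hk.add_one])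
    have h2 := mul_le_mul_of_nonneg_left (hu.succ_le k) (by positivity : (0 : ℝ) ≤ l)
    push_cast at h1
    linarith
  · obtain ⟨b, hb⟩ := hk.add_one
    obtain ⟨c, rfl⟩ := hle
    -- At 2j = q(k + 1), P_{2j} contains q disjoint copies of P_k; convexity along even indices
    -- covers the rest.
    have key := convex_seq_nonpos (h := fun j ↦ (k + 1) * u (2 * j) - (2 * j) * u k) (d := b)
      (fun j ↦ ?_) (by simp [hu.zero]) (by omega) (fun q ↦ ?_) c
    · push_cast
      rw [← two_mul]
      linarith
    · have := hu.convex j (j + 2)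
      rw [show j + (j + 2) = 2 * (j + 1) by ring] at this
      push_cast
      nlinarith [mul_le_mul_of_nonneg_left this (by positivity : (0 : ℝ) ≤ k + 1)]
    · have hbk : (k + 1 : ℝ) = b + b := by exact_mod_cast hb
      rcases q with - | q
      · simp [hu.zero]
      · have h1 := hu.split_mul k q
        have h2 := hu.succ_le ((q + 1) * (k + 1) - 1)
        have e : (q + 1) * (k + 1) - 1 + 1 = 2 * ((q + 1) * b) := by
          have : 0 < (q + 1) * (k + 1) := by positivity
          rw [Nat.sub_add_cancel this, hb]
          ring
        rw [e] at h2
        have h3 := mul_le_mul_of_nonneg_left (h2.trans h1) (by positivity : (0 : ℝ) ≤ k + 1)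
        push_cast
        rw [show 2 * (((q : ℝ) + 1) * b) = (q + 1) * (k + 1) by rw [hbk]; ring]
        linarith

lemma le_of_even_lt (hu : IsPathProfile u) {k l : ℕ} (hk : Even k) (hkl : k < l) : (k + 1) * u l ≤ (l + 1) * u k := by
  obtain ⟨b, rfl⟩ := hk
  -- At j = q(k + 1), the path with k + 2j edges splits into 2q + 1 copies of P_k. Since k + j is
  -- the midpoint of k and k + 2j, one more use of convexity reaches every l > k of either parity.
  have key := convex_seq_nonpos (d := b + b + 1)
    (h := fun j ↦ ((b + b : ℕ) + 1) * u (b + b + 2 * j) - ((b + b : ℕ) + 1 + 2 * j) * u (b + b))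
    (fun j ↦ ?_) (by simp) (by omega) (fun q ↦ ?_)
  · obtain ⟨j, rfl⟩ : ∃ j, l = b + b + j := ⟨l - (b + b), by omega⟩
    have h1 := hu.convex b (b + j)
    rw [show b + (b + j) = b + b + j by ring, show 2 * (b + j) = b + b + 2 * j by ring,
      show 2 * b = b + b by ring] at h1
    have h2 := key j
    push_cast at h2 ⊢
    nlinarith [mul_le_mul_of_nonneg_left h1 (by positivity : (0 : ℝ) ≤ b + b + 1)]
  · have := hu.convex (b + j) (b + j + 2)
    rw [show b + j + (b + j + 2) = b + b + 2 * (j + 1) by ring,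
      show 2 * (b + j) = b + b + 2 * j by ring,
      show 2 * (b + j + 2) = b + b + 2 * (j + 2) by ring] at this
    push_cast
    nlinarith [mul_le_mul_of_nonneg_left this (by positivity : (0 : ℝ) ≤ b + b + 1)]
  · have h1 := hu.split_mul (b + b) (2 * q)
    rw [show (2 * q + 1) * (b + b + 1) - 1 = b + b + 2 * (q * (b + b + 1)) by
      rw [Nat.sub_eq_iff_eq_add (Nat.succ_le_of_lt (by positivity))]; ring] at h1
    have h2 := mul_le_mul_of_nonneg_left h1 (by positivity : (0 : ℝ) ≤ b + b + 1)
    push_cast at h2 ⊢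
    linarith

lemma le_of_odd_odd_lt (hu : IsPathProfile u) {k l a r : ℕ} (hk : Odd k) (hlo : Odd l) (hl : l = a * (k + 1) + r)
    (hr : r ≤ k) : (k + l - r) * u l ≤ (a + 1) * l * u k := by
  -- The proof passes through the least L ≥ l for which P_L splits into copies of P_k. L is odd, so
  -- `growth` links l to L; L = k + l - r.
  have hL : l ≤ (a + 1) * (k + 1) - 1 := by
    rw [add_one_mul a]
    omega
  have hodd : Odd ((a + 1) * (k + 1) - 1) :=
    Nat.Even.sub_odd (by nlinarith) (hk.add_one.mul_left _) odd_one
  have h1 := hu.growth_of_parity hlo.pos hL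
    (by simp [← Nat.not_odd_iff_even, hodd, hlo])
  have h2 := mul_le_mul_of_nonneg_left (hu.split_mul k a) (by positivity : (0 : ℝ) ≤ l)
  rw [Nat.cast_sub (by nlinarith)] at h1
  have : (k + l - r : ℝ) = (a + 1) * (k + 1) - 1 := by
    rw [hl]
    push_cast
    ring
  rw [this]
  push_cast at h1
  linarith

end IsPathProfile

lemma isPathProfile_log_homDensity {U : Type*} [Fintype U] (T : SimpleGraph U) {v w : U}
    (h : T.Adj v w) : IsPathProfile fun m ↦ Real.log (homDensity (edgePath m) T) := by
  have hn : (0 : ℝ) < Fintype.card U := by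
    exact_mod_cast Fintype.card_pos_iff.mpr ⟨v⟩
  have hw := totalWalks_pos T h
  have e : ∀ m, Real.log (homDensity (edgePath m) T) =
      Real.log (totalWalks T m) - (m + 1) * Real.log (Fintype.card U) := by
    intro m
    rw [homDensity_edgePath, Real.log_div (hw m).ne' (by positivity), Real.log_pow]
    push_cast
    ring
  refine ⟨?_, fun a b ↦ ?_, fun a b ↦ ?_, fun k ↦ ?_⟩
  · simp [e, totalWalks_zero]
  · have := Real.log_le_log (pow_pos (hw _) 2) (totalWalks_sq_le T a b)
    rw [Real.log_pow, Real.log_mul (hw _).ne' (hw _).ne'] at this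
    simp only [e]
    push_cast at this ⊢
    linarith
  · have := Real.log_le_log (hw _) (totalWalks_add_add_one_le T a b)
    rw [Real.log_mul (hw _).ne' (hw _).ne'] at this
    simp only [e]
    push_cast at this ⊢
    linarith
  · have := two_mul_log_totalWalks_le T h k
    rw [Real.log_div (hw _).ne' hn.ne', Real.log_div (hw _).ne' (hw _).ne'] at this
    simp only [e]
    push_cast at this ⊢
    linarith

lemma mem_dominationSet_of_profile {k l : ℕ} (hl : 1 ≤ l) {c : ℝ} (hc : 0 < c)
    (H : ∀ u : ℕ → ℝ, IsPathProfile u → c * u l ≤ u k) :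
    c ∈ dominationSet (edgePath k) (edgePath l) := by
  intro U _ _ T
  by_cases hT : ∃ v w, T.Adj v w
  · obtain ⟨v, w, h⟩ := hT
    have hn : (0 : ℝ) < Fintype.card U := by
      exact_mod_cast Fintype.card_pos_iff.mpr ⟨v⟩
    have hpos : ∀ m, 0 < homDensity (edgePath m) T := fun m ↦ by
      rw [homDensity_edgePath]
      exact div_pos (totalWalks_pos T h m) (by positivity)
    have := H _ (isPathProfile_log_homDensity T h)
    rw [← Real.log_rpow (hpos l)] at this
    exact (Real.log_le_log_iff (Real.rpow_pos_of_pos (hpos l) c) (hpos k)).mp this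
  · have h0 : homDensity (edgePath l) T = 0 := by
      obtain ⟨m, rfl⟩ : ∃ m, l = m + 1 := ⟨l - 1, by omega⟩
      rw [homDensity_edgePath, totalWalks]
      classical
      push Not at hT
      simp [walkCount_succ, hT]
    rw [h0, Real.zero_rpow hc.ne', homDensity_edgePath]
    exact div_nonneg (totalWalks_nonneg T k) (by positivity)

end UpperBounds

/-! ### Walk densities in weighted blow-ups -/

section Blowup

variable {ι : Type}

/-- The vertex set of the blow-up of a graph on `ι` with parts of sizes `q ^ (M + 1 - 2 φ i)`. -/
abbrev BlowupVertex (φ : ι → ℕ) (M q : ℕ) : Type :=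
  Σ i : ι, Fin q × Fin (q ^ (M - 2 * φ i))

/-- The blow-up of `H` in which the pair of parts of an edge `ij` of `H` is complete if
`φ i + φ j = x`, and a disjoint union of `q` complete bipartite graphs otherwise. -/
def blowup (H : SimpleGraph ι) (φ : ι → ℕ) (x M q : ℕ) : SimpleGraph (BlowupVertex φ M q) where
  Adj v w := H.Adj v.1 w.1 ∧ (φ v.1 + φ w.1 = x ∨ v.2.1 = w.2.1)
  symm := ⟨fun v w h ↦ ⟨h.1.symm, by rw [add_comm, eq_comm (a := w.2.1)]; exact h.2⟩⟩
  loopless := ⟨fun v h ↦ H.loopless.irrefl _ h.1⟩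

variable {H : SimpleGraph ι} {φ : ι → ℕ} {x M q : ℕ}

lemma blowup_adj {v w : BlowupVertex φ M q} : (blowup H φ x M q).Adj v w ↔
    H.Adj v.1 w.1 ∧ (φ v.1 + φ w.1 = x ∨ v.2.1 = w.2.1) := Iff.rfl

-- Both kinds of pair give degree q^(M + 1 - x + φ i - φ j) from part i into part j, so the weights
-- telescope along a walk.
open Classical in
lemma sum_blowup_adj (hq : 0 < q) (hM : ∀ i, 2 * φ i ≤ M)
    (hx : ∀ i j, H.Adj i j → φ i + φ j ≤ x ∧ x ≤ φ i + φ j + 1)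
    (v : BlowupVertex φ M q) (j : ι) :
    ∑ p : Fin q × Fin (q ^ (M - 2 * φ j)), (blowup H φ x M q).adjMatrix ℝ v ⟨j, p⟩ =
      H.adjMatrix ℝ v.1 j * ((q : ℝ) ^ (M + 1) / q ^ x * q ^ φ v.1 * ((q : ℝ) ^ φ j)⁻¹) := by
  have hq0 : (q : ℝ) ≠ 0 := by positivity
  have hpow : (q : ℝ) ^ (M - 2 * φ j) = q ^ M / q ^ (2 * φ j) := by
    rw [pow_sub₀ _ hq0 (hM j), div_eq_mul_inv]
  by_cases hv : H.Adj v.1 j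
  · obtain ⟨h1, h2⟩ := hx _ _ hv
    by_cases he : φ v.1 + φ j = x
    · simp only [SimpleGraph.adjMatrix_apply, blowup_adj, hv, he, true_and, true_or, if_true,
        sum_const, card_univ, Fintype.card_prod, Fintype.card_fin, nsmul_eq_mul, mul_one, one_mul]
      push_cast
      rw [hpow, ← he]
      field_simp
      ring
    · have he' : x = φ v.1 + φ j + 1 := by omega
      have hadj : ∀ y z, (blowup H φ x M q).adjMatrix ℝ v ⟨j, (y, z)⟩ =
          if v.2.1 = y then 1 else 0 := fun y z ↦ by
        rw [SimpleGraph.adjMatrix_apply]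
        exact if_congr (by simp [blowup_adj, hv, he]) rfl rfl
      rw [Fintype.sum_prod_type]
      simp only [hadj, sum_const, card_univ, Fintype.card_fin, nsmul_eq_mul, mul_ite, mul_one,
        mul_zero, sum_ite_eq, mem_univ, SimpleGraph.adjMatrix_apply, hv, if_true, one_mul]
      push_cast
      rw [hpow, he']
      field_simp
      ring
  · simp [blowup_adj, hv]

variable [Fintype ι]

open Classical in
lemma walkCount_blowup (hq : 0 < q) (hM : ∀ i, 2 * φ i ≤ M)
    (hx : ∀ i j, H.Adj i j → φ i + φ j ≤ x ∧ x ≤ φ i + φ j + 1) (m : ℕ)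
    (v : BlowupVertex φ M q) :
    walkCount (blowup H φ x M q) m v = ((q : ℝ) ^ (M + 1) / q ^ x) ^ m * q ^ φ v.1 *
      (H.adjMatrix ℝ ^ m *ᵥ fun i ↦ ((q : ℝ) ^ φ i)⁻¹) v.1 := by
  have hq0 : (q : ℝ) ≠ 0 := by positivity
  induction m generalizing v with
  | zero => simp [walkCount_zero, hq0]
  | succ m ih =>
    rw [walkCount_succ, Fintype.sum_sigma]
    simp only [ih]
    simp only [← sum_mul, sum_blowup_adj hq hM hx]
    rw [pow_succ' (H.adjMatrix ℝ), ← mulVec_mulVec, mulVec, dotProduct, mul_sum]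
    refine sum_congr rfl fun j _ ↦ ?_
    generalize (q : ℝ) ^ (M + 1) / q ^ x = D
    generalize (H.adjMatrix ℝ ^ m *ᵥ fun i ↦ ((q : ℝ) ^ φ i)⁻¹) j = X
    field_simp
    ring

open Classical in
lemma totalWalks_blowup (hq : 0 < q) (hM : ∀ i, 2 * φ i ≤ M)
    (hx : ∀ i j, H.Adj i j → φ i + φ j ≤ x ∧ x ≤ φ i + φ j + 1) (m : ℕ) :
    totalWalks (blowup H φ x M q) m = (q : ℝ) ^ (M + 1) * ((q : ℝ) ^ (M + 1) / q ^ x) ^ m *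
      ∑ i, ∑ j, (H.adjMatrix ℝ ^ m) i j * ((q : ℝ) ^ (φ i + φ j))⁻¹ := by
  have hq0 : (q : ℝ) ≠ 0 := by positivity
  rw [totalWalks, Fintype.sum_sigma, mul_sum]
  refine sum_congr rfl fun i _ ↦ ?_
  simp only [walkCount_blowup hq hM hx, sum_const, card_univ, Fintype.card_prod,
    Fintype.card_fin, nsmul_eq_mul, mulVec, dotProduct, mul_sum]
  refine sum_congr rfl fun j _ ↦ ?_
  push_cast
  rw [pow_sub₀ _ hq0 (hM i), pow_add _ (φ i)]
  field_simp
  ring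

lemma le_card_blowupVertex (h0 : ∃ i, φ i = 0) :
    q ^ (M + 1) ≤ Fintype.card (BlowupVertex φ M q) := by
  obtain ⟨i, hi⟩ := h0
  rw [Fintype.card_sigma]
  refine le_trans ?_ (single_le_sum (fun _ _ ↦ Nat.zero_le _) (mem_univ i))
  simp [hi, pow_succ']

lemma card_blowupVertex_le (hq : 0 < q) :
    Fintype.card (BlowupVertex φ M q) ≤ Fintype.card ι * q ^ (M + 1) := by
  rw [Fintype.card_sigma]
  refine (sum_le_card_nsmul _ _ (q ^ (M + 1)) fun i _ ↦ ?_).trans (by simp)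
  rw [Fintype.card_prod, Fintype.card_fin, Fintype.card_fin, pow_succ']
  exact Nat.mul_le_mul_left q (Nat.pow_le_pow_right hq (Nat.sub_le _ _))

lemma homDensity_blowup_le (hq : 0 < q) (hM : ∀ i, 2 * φ i ≤ M) (h0 : ∃ i, φ i = 0)
    (hx : ∀ i j, H.Adj i j → φ i + φ j ≤ x ∧ x ≤ φ i + φ j + 1) {k α : ℕ}
    (hα : ∀ i j, ∀ p : H.Walk i j, p.length = k → α ≤ φ i + φ j) :
    homDensity (edgePath k) (blowup H φ x M q) ≤
      totalWalks H k * ((q : ℝ) ^ (x * k + α))⁻¹ := by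
  classical
  have hq0 : (0 : ℝ) < q := by exact_mod_cast hq
  have hq1 : (1 : ℝ) ≤ q := by exact_mod_cast hq
  have hcard : (q : ℝ) ^ (M + 1) ≤ Fintype.card (BlowupVertex φ M q) := by
    exact_mod_cast le_card_blowupVertex h0
  have hsum : ∑ i, ∑ j, (H.adjMatrix ℝ ^ k) i j * ((q : ℝ) ^ (φ i + φ j))⁻¹ ≤
      totalWalks H k * ((q : ℝ) ^ α)⁻¹ := by
    have e : totalWalks H k = ∑ i, ∑ j, (H.adjMatrix ℝ ^ k) i j := by
      simp [totalWalks, walkCount, mulVec, dotProduct]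
    rw [e, sum_mul]
    refine sum_le_sum fun i _ ↦ ?_
    rw [sum_mul]
    refine sum_le_sum fun j _ ↦ ?_
    rw [SimpleGraph.adjMatrix_pow_apply_eq_card_walk]
    rcases Nat.eq_zero_or_pos (Fintype.card {p : H.Walk i j | p.length = k}) with hc | hc
    · simp [hc]
    · obtain ⟨p, hp⟩ := Fintype.card_pos_iff.mp hc
      gcongr
      exact hα i j p hp
  rw [homDensity_edgePath, totalWalks_blowup hq hM hx]
  have hnn := totalWalks_nonneg H k
  calc
    _ ≤ (q : ℝ) ^ (M + 1) * ((q : ℝ) ^ (M + 1) / q ^ x) ^ k *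
        (totalWalks H k * ((q : ℝ) ^ α)⁻¹) / ((q : ℝ) ^ (M + 1)) ^ (k + 1) := by gcongr
    _ = _ := by
      rw [pow_add _ (x * k), pow_mul, div_pow, pow_succ _ k]
      field_simp

lemma le_homDensity_blowup (hq : 0 < q) (hM : ∀ i, 2 * φ i ≤ M)
    (hx : ∀ i j, H.Adj i j → φ i + φ j ≤ x ∧ x ≤ φ i + φ j + 1) {i j : ι} (p : H.Walk i j) :
    ((Fintype.card ι : ℝ) ^ (p.length + 1))⁻¹ *
      ((q : ℝ) ^ (x * p.length + (φ i + φ j)))⁻¹ ≤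
      homDensity (edgePath p.length) (blowup H φ x M q) := by
  classical
  have hq0 : (0 : ℝ) < q := by exact_mod_cast hq
  have hι : (0 : ℝ) < Fintype.card ι := by exact_mod_cast Fintype.card_pos_iff.mpr ⟨i⟩
  have hcard : (Fintype.card (BlowupVertex φ M q) : ℝ) ≤ Fintype.card ι * (q : ℝ) ^ (M + 1) := by
    exact_mod_cast card_blowupVertex_le hq
  have hpos : (0 : ℝ) < Fintype.card (BlowupVertex φ M q) := by
    have : 0 < q ^ (M - 2 * φ i) := by positivity
    have : Nonempty (BlowupVertex φ M q) := ⟨⟨i, ⟨0, hq⟩, ⟨0, this⟩⟩⟩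
    exact_mod_cast Fintype.card_pos
  have hterm : ∀ i j, 0 ≤ (H.adjMatrix ℝ ^ p.length) i j * ((q : ℝ) ^ (φ i + φ j))⁻¹ := by
    intro i j
    rw [SimpleGraph.adjMatrix_pow_apply_eq_card_walk]
    positivity
  have hsum : ((q : ℝ) ^ (φ i + φ j))⁻¹ ≤
      ∑ i, ∑ j, (H.adjMatrix ℝ ^ p.length) i j * ((q : ℝ) ^ (φ i + φ j))⁻¹ := by
    refine le_trans ?_ (single_le_sum (fun i _ ↦ sum_nonneg fun j _ ↦ hterm i j) (mem_univ i))
    refine le_trans ?_ (single_le_sum (fun j _ ↦ hterm i j) (mem_univ j))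
    refine le_mul_of_one_le_left (by positivity) ?_
    rw [SimpleGraph.adjMatrix_pow_apply_eq_card_walk]
    have : Nonempty {p' : H.Walk i j | p'.length = p.length} := ⟨⟨p, rfl⟩⟩
    exact_mod_cast Fintype.card_pos
  rw [homDensity_edgePath, totalWalks_blowup hq hM hx]
  calc
    _ = (q : ℝ) ^ (M + 1) * ((q : ℝ) ^ (M + 1) / q ^ x) ^ p.length *
        ((q : ℝ) ^ (φ i + φ j))⁻¹ / (Fintype.card ι * (q : ℝ) ^ (M + 1)) ^ (p.length + 1) := by
      rw [pow_add _ (x * p.length), pow_mul, div_pow, mul_pow, pow_succ _ p.length,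
        pow_succ ((q : ℝ) ^ (M + 1)) p.length]
      field_simp
    _ ≤ _ := by
      gcongr
      exact mul_nonneg (by positivity) (sum_nonneg fun i _ ↦ sum_nonneg fun j _ ↦ hterm i j)

end Blowup

/-! ### Comparing exponents as q tends to infinity -/

section LowerBound

lemma exponent_le_of_pow_bounds {A B c : ℝ} (hB : 0 < B) {a b : ℕ}
    (h : ∀ q : ℕ, 0 < q → (B * ((q : ℝ) ^ b)⁻¹) ^ c ≤ A * ((q : ℝ) ^ a)⁻¹) : (a : ℝ) ≤ c * b := by
  by_contra! hlt
  have hBc : 0 < B ^ c := Real.rpow_pos_of_pos hB c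
  have hbound : ∀ q : ℕ, 0 < q → (q : ℝ) ^ ((a : ℝ) - c * b) ≤ A / B ^ c := by
    intro q hq
    have hq0 : (0 : ℝ) < q := by exact_mod_cast hq
    have := h q hq
    rw [Real.mul_rpow hB.le (by positivity), ← Real.rpow_natCast, ← Real.rpow_natCast,
      ← Real.rpow_neg hq0.le, ← Real.rpow_neg hq0.le, ← Real.rpow_mul hq0.le] at this
    rw [le_div_iff₀ hBc, sub_eq_add_neg, Real.rpow_add hq0]
    have h2 := mul_le_mul_of_nonneg_left this (Real.rpow_nonneg hq0.le (a : ℝ))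
    rw [mul_left_comm _ A, ← Real.rpow_add hq0, add_neg_cancel, Real.rpow_zero, mul_one] at h2
    rw [show -(b : ℝ) * c = -(c * b) by ring] at h2
    linarith
  have hlim : Filter.Tendsto (fun q : ℕ ↦ (q : ℝ) ^ ((a : ℝ) - c * b)) Filter.atTop Filter.atTop :=
    (tendsto_rpow_atTop (sub_pos.mpr hlt)).comp tendsto_natCast_atTop_atTop
  obtain ⟨q, hq, hq0⟩ := ((hlim.eventually_gt_atTop (A / B ^ c)).and
    (Filter.eventually_gt_atTop 0)).exists
  exact absurd (hbound q hq0) hq.not_ge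

/-- A weighted graph `H` bounds the exponents in the domination set from below: walks with `k`
edges in its blow-ups cost at least `x k + α`, and some walk with `l` edges costs
`x l + φ i + φ j`. -/
lemma le_mul_of_mem_dominationSet {ι : Type} [Fintype ι] {H : SimpleGraph ι} {φ : ι → ℕ}
    {x k l α : ℕ} (h0 : ∃ i, φ i = 0)
    (hx : ∀ i j, H.Adj i j → φ i + φ j ≤ x ∧ x ≤ φ i + φ j + 1) (hx0 : 0 < x) (hk : 0 < k)
    (hα : ∀ i j, ∀ p : H.Walk i j, p.length = k → α ≤ φ i + φ j)
    {i j : ι} (p : H.Walk i j) (hp : p.length = l) {c : ℝ}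
    (hc : c ∈ dominationSet (edgePath k) (edgePath l)) :
    (x * k + α : ℝ) ≤ c * (x * l + (φ i + φ j)) := by
  subst hp
  have hM : ∀ i, 2 * φ i ≤ 2 * ∑ j, φ j := fun i ↦
    Nat.mul_le_mul_left 2 (single_le_sum (fun _ _ ↦ Nat.zero_le _) (mem_univ i))
  have hι : (0 : ℝ) < Fintype.card ι := by exact_mod_cast Fintype.card_pos_iff.mpr ⟨i⟩
  set M := 2 * ∑ j, φ j with hMdef
  have hlow := fun q (hq : 0 < q) ↦ le_homDensity_blowup hq hM hx p
  have hupp := fun q (hq : 0 < q) ↦ homDensity_blowup_le hq hM h0 hx hα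
  have hdom : ∀ q : ℕ, 0 < q → homDensity (edgePath p.length) (blowup H φ x M q) ^ c ≤
      homDensity (edgePath k) (blowup H φ x M q) := by
    intro q hq
    have : 0 < q ^ (M - 2 * φ i) := by positivity
    have : Nonempty (BlowupVertex φ M q) := ⟨⟨i, ⟨0, hq⟩, ⟨0, this⟩⟩⟩
    exact hc _ _
  have hxk : 0 < x * k + α := by positivity
  -- For c < 0 the bounded density of P_l would keep that of P_k away from 0, although it decays
  -- like a positive power of 1/q. The sign is needed for monotonicity of the power.
  have hcpos : 0 ≤ c := by
    by_contra! hneg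
    have hle1 : ∀ q : ℕ, 0 < q → homDensity (edgePath p.length) (blowup H φ x M q) ≤
        totalWalks H p.length := by
      intro q hq
      have := homDensity_blowup_le hq hM h0 hx (k := p.length) (α := 0) fun _ _ _ _ ↦ Nat.zero_le _
      refine this.trans (mul_le_of_le_one_right (totalWalks_nonneg H _) (inv_le_one_of_one_le₀ ?_))
      exact one_le_pow₀ (by exact_mod_cast hq)
    have hpos : ∀ q : ℕ, 0 < q → 0 < homDensity (edgePath p.length) (blowup H φ x M q) := by
      intro q hq
      have hq0 : (0 : ℝ) < q := by exact_mod_cast hq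
      exact lt_of_lt_of_le (by positivity) (hlow q hq)
    have hC : 0 < totalWalks H p.length := (hpos 1 one_pos).trans_le (hle1 1 one_pos)
    have := exponent_le_of_pow_bounds (A := totalWalks H k) (c := c) hC (a := x * k + α) (b := 0) fun q hq ↦ by
      rw [pow_zero, inv_one, mul_one]
      exact ((Real.rpow_le_rpow_of_nonpos (hpos q hq) (hle1 q hq) hneg.le).trans
        (hdom q hq)).trans (hupp q hq)
    rw [Nat.cast_zero, mul_zero] at this
    exact absurd this (by exact_mod_cast hxk.not_ge)
  have := exponent_le_of_pow_bounds (A := totalWalks H k) (c := c)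
    (B := ((Fintype.card ι : ℝ) ^ (p.length + 1))⁻¹) (by positivity)
    (b := x * p.length + (φ i + φ j)) fun q hq ↦
      ((Real.rpow_le_rpow (by positivity) (hlow q hq) hcpos).trans (hdom q hq)).trans (hupp q hq)
  exact_mod_cast this

end LowerBound

/-! ### Walks in the weighted graphs -/

section Walks

lemma pathGraph_walk_length {n : ℕ} {i j : Fin n} (p : (SimpleGraph.pathGraph n).Walk i j) :
    Even (i.val + j.val + p.length) ∧ i.val ≤ j.val + p.length ∧ j.val ≤ i.val + p.length := by
  induction p with
  | nil => simp
  | @cons u v w h p ih =>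
    obtain ⟨h1, h2, h3⟩ := ih
    rw [SimpleGraph.Walk.length_cons, Nat.even_iff]
    rw [Nat.even_iff] at h1
    rcases SimpleGraph.pathGraph_adj.mp h with h | h <;> omega

lemma exists_walk_length_eq {V : Type*} {H : SimpleGraph V} {i j : V} (h : H.Adj i j) (m : ℕ) :
    ∃ e, (e = i ∨ e = j) ∧ ∃ p : H.Walk i e, p.length = m := by
  induction m with
  | zero => exact ⟨i, Or.inl rfl, .nil, rfl⟩
  | succ m ih =>
    obtain ⟨e, rfl | rfl, p, rfl⟩ := ih
    · exact ⟨j, Or.inr rfl, p.concat h, p.length_concat h⟩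
    · exact ⟨i, Or.inl rfl, p.concat h.symm, p.length_concat h.symm⟩

lemma exists_pathGraph_walk (l m : ℕ) (hm : m < l + 1) :
    ∃ p : (SimpleGraph.pathGraph (l + 1)).Walk 0 ⟨m, hm⟩, p.length = m := by
  induction m with
  | zero => exact ⟨.nil, rfl⟩
  | succ m ih =>
    obtain ⟨p, hp⟩ := ih (by omega)
    have h : (SimpleGraph.pathGraph (l + 1)).Adj ⟨m, by omega⟩ ⟨m + 1, hm⟩ :=
      SimpleGraph.pathGraph_adj.mpr (Or.inl rfl)
    exact ⟨p.concat h, by rw [SimpleGraph.Walk.length_concat, hp]⟩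

end Walks

/-! ### Extremal weighted graphs and the theorem -/

section MainTheorem

lemma le_mul_of_mem_dominationSet_edgePath {k l : ℕ} (hk : 1 ≤ k) {c : ℝ}
    (hc : c ∈ dominationSet (edgePath k) (edgePath l)) : (k : ℝ) ≤ c * l := by
  have h : (SimpleGraph.pathGraph 2).Adj 0 1 := SimpleGraph.pathGraph_adj.mpr (Or.inl rfl)
  obtain ⟨e, -, p, hp⟩ := exists_walk_length_eq h l
  -- The blow-up is q disjoint copies of a balanced complete bipartite graph.
  simpa using le_mul_of_mem_dominationSet (φ := fun _ ↦ 0) (x := 1) (α := 0) ⟨0, rfl⟩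
    (by simp) one_pos hk (by simp) p hp hc

lemma add_one_le_mul_of_mem_dominationSet_odd_even {k l : ℕ} (hk : Odd k) (hl : Even l) {c : ℝ}
    (hc : c ∈ dominationSet (edgePath k) (edgePath l)) : (k + 1 : ℝ) ≤ c * l := by
  have h : (SimpleGraph.pathGraph 2).Adj 0 1 := SimpleGraph.pathGraph_adj.mpr (Or.inl rfl)
  obtain ⟨e, -, p, hp⟩ := exists_walk_length_eq h l
  have he : e.val = 0 := by
    have := (pathGraph_walk_length p).1
    rw [Nat.even_iff] at this hl
    have h0 : ((0 : Fin 2) : ℕ) = 0 := rfl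
    omega
  -- An unbalanced complete bipartite graph: an even walk can have both ends in the large part, an
  -- odd one cannot.
  have := le_mul_of_mem_dominationSet (φ := Fin.val) (x := 1) (α := 1) ⟨0, rfl⟩
    (fun i j hij ↦ by have := SimpleGraph.pathGraph_adj.mp hij; omega) one_pos hk.pos
    (fun i j p hp ↦ by
      have := (pathGraph_walk_length p).1
      rw [Nat.even_iff] at this
      rw [Nat.odd_iff] at hk
      omega) p hp hc
  simpa [he] using this

/-- An edge together with an isolated vertex `0`. -/
def edgeWithIsolated : SimpleGraph (Fin 3) where
  Adj i j := i ≠ 0 ∧ j ≠ 0 ∧ i ≠ j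
  symm := ⟨fun _ _ h ↦ ⟨h.2.1, h.1, h.2.2.symm⟩⟩
  loopless := ⟨fun _ h ↦ h.2.2 rfl⟩

lemma edgeWithIsolated_walk {i j : Fin 3} (p : edgeWithIsolated.Walk i j) (hp : 0 < p.length) :
    i ≠ 0 := by
  cases p with
  | nil => simp at hp
  | cons h p => exact h.1

lemma add_one_le_mul_add_one_of_mem_dominationSet {k l : ℕ} (hk : 1 ≤ k) {c : ℝ}
    (hc : c ∈ dominationSet (edgePath k) (edgePath l)) : (k + 1 : ℝ) ≤ c * (l + 1) := by
  have h : edgeWithIsolated.Adj 1 2 := by simp [edgeWithIsolated]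
  obtain ⟨e, he, p, hp⟩ := exists_walk_length_eq h l
  have he0 : e ≠ 0 := by rcases he with rfl | rfl <;> decide
  -- A small complete bipartite graph amid isolated vertices: every vertex of a walk costs q^(-2).
  have := le_mul_of_mem_dominationSet (φ := fun i : Fin 3 ↦ if i = 0 then 0 else 1) (x := 2)
    (α := 2) ⟨0, rfl⟩ (fun i j hij ↦ by simp [hij.1, hij.2.1]) two_pos hk
    (fun i j p hp ↦ by
      have h1 := edgeWithIsolated_walk p (by omega)
      have h2 := edgeWithIsolated_walk p.reverse (by rw [SimpleGraph.Walk.length_reverse]; omega)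
      simp [h1, h2]) p hp hc
  simp only [he0, if_false, one_ne_zero] at this
  push_cast at this
  linarith

lemma le_mul_of_mem_dominationSet_odd_odd {k l a r : ℕ} (hk : Odd k) (hl : Odd l)
    (hla : l = a * (k + 1) + r) (hr : r ≤ k) {c : ℝ}
    (hc : c ∈ dominationSet (edgePath k) (edgePath l)) :
    (k + l - r : ℝ) ≤ c * ((a + 1) * l) := by
  obtain ⟨p, hp⟩ := exists_pathGraph_walk l l (by omega)
  -- Weights are ⌈i/(k+1)⌉ at even i and a + 1 - ⌈(i+1)/(k+1)⌉ at odd i. Both ends of the path get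
  -- 0, so the full walk is cheap, while the ends of a k-edge walk, having opposite parity and
  -- distance at most k, have total weight at least a.
  let φ : Fin (l + 1) → ℕ := fun i ↦
    if Even i.val then (i.val + k) / (k + 1) else a + 1 - (i.val + 1 + k) / (k + 1)
  have heven : ∀ i, Even i.val → φ i = (i.val + k) / (k + 1) := fun i hi ↦ if_pos hi
  have hodd : ∀ i, ¬Even i.val → φ i + (i.val + 1 + k) / (k + 1) = a + 1 := by
    intro i hi
    have : (i.val + 1 + k) / (k + 1) < a + 2 := by
      rw [Nat.div_lt_iff_lt_mul (by omega)]
      have := i.isLt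
      nlinarith
    simp only [φ, hi, if_false]
    omega
  have h0 : φ 0 = 0 := by
    rw [heven _ (by simp)]
    exact Nat.div_eq_of_lt (by simp)
  have hlast : φ ⟨l, by omega⟩ = 0 := by
    have h1 := hodd ⟨l, by omega⟩ (by simpa using hl)
    have h2 : (l + 1 + k) / (k + 1) = a + 1 := by
      rw [Nat.div_eq_iff (by omega), hla, add_one_mul a]
      constructor <;> omega
    simp only [h2] at h1
    omega
  have hnear : ∀ i j : Fin (l + 1), Even i.val → ¬Even j.val → j.val ≤ i.val + k →
      a ≤ φ i + φ j := by
    intro i j hi hj hij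
    have h1 := hodd j hj
    have h2 : (j.val + 1 + k) / (k + 1) ≤ (i.val + k) / (k + 1) + 1 := by
      rw [← Nat.add_div_right _ (by omega)]
      exact Nat.div_le_div_right (by omega)
    rw [heven i hi]
    omega
  have hadj : ∀ i j : Fin (l + 1), Even i.val → ¬Even j.val → i.val ≤ j.val + 1 →
      φ i + φ j ≤ a + 1 := by
    intro i j hi hj hij
    have h1 := hodd j hj
    have h2 : (i.val + k) / (k + 1) ≤ (j.val + 1 + k) / (k + 1) :=
      Nat.div_le_div_right (by omega)
    rw [heven i hi]
    omega
  have hk1 := hk.pos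
  have key := le_mul_of_mem_dominationSet (φ := φ) (x := a + 1) (α := a) ⟨0, h0⟩
    (fun i j hij ↦ by
      have hij' := SimpleGraph.pathGraph_adj.mp hij
      by_cases hi : Even i.val
      · have hj : ¬Even j.val := by rw [Nat.even_iff] at hi ⊢; omega
        exact ⟨hadj i j hi hj (by omega), Nat.succ_le_succ (hnear i j hi hj (by omega))⟩
      · have hj : Even j.val := by rw [Nat.even_iff] at hi ⊢; omega
        rw [add_comm (φ i)]
        exact ⟨hadj j i hj hi (by omega), Nat.succ_le_succ (hnear j i hj hi (by omega))⟩)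
    a.succ_pos hk1
    (fun i j p hp ↦ by
      obtain ⟨h1, h2, h3⟩ := pathGraph_walk_length p
      rw [hp, Nat.even_iff] at h1
      rw [Nat.odd_iff] at hk
      by_cases hi : Even i.val
      · have hj : ¬Even j.val := by rw [Nat.even_iff] at hi ⊢; omega
        exact hnear i j hi hj (by omega)
      · have hj : Even j.val := by rw [Nat.even_iff] at hi ⊢; omega
        rw [add_comm (φ i)]
        exact hnear j i hj hi (by omega)) p hp hc
  rw [h0, hlast] at key
  have e : (l : ℝ) = a * (k + 1) + r := by exact_mod_cast hla
  push_cast at key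
  calc (k + l - r : ℝ) = (a + 1) * k + a := by rw [e]; ring
    _ ≤ c * ((a + 1) * l) := by linarith

lemma isDominationExponent_of_profile {k l : ℕ} (hl : 1 ≤ l) {x y : ℝ} (hx : 0 < x) (hy : 0 < y)
    (hupper : ∀ u : ℕ → ℝ, IsPathProfile u → x * u l ≤ y * u k)
    (hlower : ∀ c ∈ dominationSet (edgePath k) (edgePath l), x ≤ c * y) :
    IsDominationExponent (edgePath k) (edgePath l) (x / y) := by
  refine ⟨mem_dominationSet_of_profile hl (div_pos hx hy) fun u hu ↦ ?_, fun c hc ↦ ?_⟩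
  · rw [div_mul_eq_mul_div, div_le_iff₀ hy, mul_comm (u k)]
    exact hupper u hu
  · exact (div_le_iff₀ hy).mpr (hlower c hc)

theorem mainTheorem2 (k ℓ : ℕ) (hk : 1 ≤ k) (hℓ : 1 ≤ ℓ) :
    (k > ℓ → (Even k ∨ (Odd k ∧ Odd ℓ)) →
      IsDominationExponent (edgePath k) (edgePath ℓ) ((k : ℝ) / (ℓ : ℝ))) ∧
    (Odd k → Even ℓ →
      IsDominationExponent (edgePath k) (edgePath ℓ) (((k : ℝ) + 1) / (ℓ : ℝ))) ∧
    (k < ℓ → Even k →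
      IsDominationExponent (edgePath k) (edgePath ℓ) (((k : ℝ) + 1) / ((ℓ : ℝ) + 1))) ∧
    (k < ℓ → Odd k → Odd ℓ → ∀ a r : ℕ, ℓ = a * (k + 1) + r → r ≤ k →
      IsDominationExponent (edgePath k) (edgePath ℓ)
        (((k : ℝ) + (ℓ : ℝ) - (r : ℝ)) / (((a : ℝ) + 1) * (ℓ : ℝ)))) ∧
    (k = ℓ → IsDominationExponent (edgePath k) (edgePath ℓ) 1) := by
  have hk0 : (0 : ℝ) < k := by exact_mod_cast hk
  have hℓ0 : (0 : ℝ) < ℓ := by exact_mod_cast hℓ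
  refine ⟨fun hkl hpar ↦ ?_, fun hko hle ↦ ?_, fun hkl hke ↦ ?_,
    fun hkl hko hlo a r hla hr ↦ ?_, ?_⟩
  · refine isDominationExponent_of_profile hℓ hk0 hℓ0 (fun u hu ↦ ?_) fun c hc ↦
      le_mul_of_mem_dominationSet_edgePath hk hc
    rcases hpar with he | ⟨hko, hlo⟩
    · exact hu.le_of_even hℓ hkl he
    · exact hu.growth_of_parity hℓ hkl.le (by simp [← Nat.not_odd_iff_even, hko, hlo])
  · exact isDominationExponent_of_profile hℓ (by positivity) hℓ0
      (fun u hu ↦ hu.le_of_odd_even hℓ hko hle) fun c hc ↦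
      add_one_le_mul_of_mem_dominationSet_odd_even hko hle hc
  · exact isDominationExponent_of_profile hℓ (by positivity) (by positivity)
      (fun u hu ↦ hu.le_of_even_lt hke hkl) fun c hc ↦
      add_one_le_mul_add_one_of_mem_dominationSet hk hc
  · have hr' : (r : ℝ) ≤ k := by exact_mod_cast hr
    exact isDominationExponent_of_profile hℓ (by linarith) (by positivity)
      (fun u hu ↦ hu.le_of_odd_odd_lt hko hlo hla hr) fun c hc ↦
      le_mul_of_mem_dominationSet_odd_odd hko hlo hla hr hc
  · rintro rfl
    rw [← div_self hk0.ne']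
    exact isDominationExponent_of_profile hk hk0 hk0 (fun u _ ↦ le_rfl) fun c hc ↦
      le_mul_of_mem_dominationSet_edgePath hk hc

end MainTheorem
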